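/- A modal algebra is a Boolean algebra $B$ (possibly the one-element one) with an operator $\Diamond : B \to B$ such that $\Diamond(a\vee b)=\Diamond a\vee\Diamond b$ and $\Diamond\bot=\bot$; let $\mathbf{MA}$ be the category of modal algebras, with Boolean algebra homomorphisms commuting with $\Diamond$ as morphisms, and let $\mathbf{MA}_f$ be its full subcategory of finite modal algebras. A Kripke frame is a set $P$ with a binary relation $R$; a p-morphism $(P,R)\to(Q,S)$ is a function $f:P\to Q$ such that $p\,R\,p'$ implies $f(p)\,S\,f(p')$, and such that whenever $f(p)\,S\,q'$ there is $p'\in P$ with $p\,R\,p'$ and $f(p')=q'$. The frame $(P,R)$ is locally finite if for every $p\in P$ the set $R^*(p)=\{q\in P \mid p\,R^*q\}$ is finite, where $R^*$ is the reflexive-transitive closure of $R$. Let $\mathbf{KFr}_{lf}$ be the category of locally finite Kripke frames and p-morphisms. For an essentially small category $\mathcal C$, let $\mathrm{Ind}\text{-}\mathcal C$ be the full subcategory of $\mathbf{Set}^{\mathcal C^{\mathrm{op}}}$ consisting of the (small) filtered colimits of representable functors, and let $\mathrm{Pro}\text{-}\mathcal C=(\mathrm{Ind}\text{-}(\mathcal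 C^{\mathrm{op}}))^{\mathrm{op}}$. **Theorem.** The category $\mathrm{Pro}\text{-}\mathbf{MA}_f$ is dual to $\mathbf{KFr}_{lf}$, i.e. there is an equivalence of categories $\mathrm{Pro}\text{-}\mathbf{MA}_f\simeq(\mathbf{KFr}_{lf})^{\mathrm{op}}$. -/

import Mathlib

open CategoryTheory

universe u v w

/-- A modal algebra: a Boolean algebra with a finite-join preserving operator `dia`. The trivial
one-element algebra is allowed. -/
class ModalAlgebra (B : Type u) extends BooleanAlgebra B where
  /-- The possibility operator. -/
  dia : B → B
  dia_sup : ∀ a b : B, dia (a ⊔ b) = dia a ⊔ dia b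
  dia_bot : dia ⊥ = ⊥

/-- A morphism of modal algebras: a Boolean morphism (a map preserving `⊔`, `⊓`, `⊤`, `⊥`, and
hence complements) that preserves the possibility operator. -/
@[ext]
structure ModalHom (A : Type u) (B : Type v) [ModalAlgebra A] [ModalAlgebra B] where
  /-- The underlying Boolean morphism. -/
  toHom : BoundedLatticeHom A B
  map_dia : ∀ a : A, toHom (ModalAlgebra.dia a) = ModalAlgebra.dia (toHom a)

/-- The identity morphism of a modal algebra. -/
def ModalHom.id (A : Type u) [ModalAlgebra A] : ModalHom A A where
  toHom := BoundedLatticeHom.id A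
  map_dia _ := rfl

/-- The composite of two morphisms of modal algebras, first `f`, then `g`. -/
def ModalHom.comp {A : Type u} {B : Type v} {C : Type w} [ModalAlgebra A] [ModalAlgebra B]
    [ModalAlgebra C] (f : ModalHom A B) (g : ModalHom B C) : ModalHom A C where
  toHom := g.toHom.comp f.toHom
  map_dia a := by
    simp only [BoundedLatticeHom.comp_apply, f.map_dia, g.map_dia]

/-- Bundled modal algebras, the objects of the category `MA`. -/
structure ModAlg where
  /-- The underlying set. -/
  carrier : Type u
  [str : ModalAlgebra carrier]

attribute [instance] ModAlg.str

/-- The category `MA` of modal algebras. -/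
instance : Category.{u} ModAlg.{u} where
  Hom A B := ModalHom A.carrier B.carrier
  id A := ModalHom.id A.carrier
  comp f g := ModalHom.comp f g
  id_comp _ := rfl
  comp_id _ := rfl
  assoc _ _ _ := rfl

/-- The category `MA_f`: the full subcategory of `MA` formed by the finite modal algebras. -/
abbrev FinModAlg : Type (u + 1) :=
  ObjectProperty.FullSubcategory (fun A : ModAlg.{u} => Finite A.carrier)

/-- A Kripke frame: a set with an arbitrary binary relation. -/
structure KripkeFrame where
  /-- The underlying set. -/
  carrier : Type u
  /-- The accessibility relation. -/
  rel : carrier → carrier → Prop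

/-- A p-morphism of Kripke frames: a function that is stable and open. -/
@[ext]
structure PMorphism (P : KripkeFrame.{u}) (Q : KripkeFrame.{v}) where
  /-- The underlying function. -/
  toFun : P.carrier → Q.carrier
  stable : ∀ p p' : P.carrier, P.rel p p' → Q.rel (toFun p) (toFun p')
  isOpen : ∀ (p : P.carrier) (q' : Q.carrier), Q.rel (toFun p) q' →
    ∃ p' : P.carrier, P.rel p p' ∧ toFun p' = q'

/-- The identity p-morphism. -/
def PMorphism.id (P : KripkeFrame.{u}) : PMorphism P P where
  toFun p := p
  stable _ _ h := h
  isOpen _ q' h := ⟨q', h, rfl⟩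

/-- The composite of two p-morphisms, first `f`, then `g`. -/
def PMorphism.comp {P : KripkeFrame.{u}} {Q : KripkeFrame.{v}} {T : KripkeFrame.{w}}
    (f : PMorphism P Q) (g : PMorphism Q T) : PMorphism P T where
  toFun p := g.toFun (f.toFun p)
  stable p p' h := g.stable _ _ (f.stable p p' h)
  isOpen p t h := by
    obtain ⟨q, hq, rfl⟩ := g.isOpen _ t h
    obtain ⟨p', hp', rfl⟩ := f.isOpen p q hq
    exact ⟨p', hp', rfl⟩

/-- The category `KFr` of Kripke frames and p-morphisms. -/
instance : Category.{u} KripkeFrame.{u} where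
  Hom P Q := PMorphism P Q
  id P := PMorphism.id P
  comp f g := PMorphism.comp f g
  id_comp _ := rfl
  comp_id _ := rfl
  assoc _ _ _ := rfl

/-- A Kripke frame `(P, R)` is locally finite if, for every point `p`, the set `R*(p)` of the points
reachable from `p` under the reflexive-transitive closure of `R` is finite. -/
def KripkeFrame.IsLocallyFinite (P : KripkeFrame.{u}) : Prop :=
  ∀ p : P.carrier, {q : P.carrier | Relation.ReflTransGen P.rel p q}.Finite

/-- The category `KFr_lf`: the full subcategory of `KFr` formed by the locally finite frames. -/
abbrev LFKripkeFrame : Type (u + 1) :=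
  ObjectProperty.FullSubcategory (fun P : KripkeFrame.{u} => P.IsLocallyFinite)

/-- The Pro-completion `Pro-C := (Ind-(Cᵒᵖ))ᵒᵖ`. Here `Ind D` is Mathlib's category of ind-objects:
up to the size of its hom-sets it is the full subcategory of the presheaf category `Dᵒᵖ ⥤ Type v`
formed by the small filtered colimits of representable functors. -/
abbrev ProCompletion (C : Type u) [Category.{v} C] : Type (max u (v + 1)) :=
  (Ind Cᵒᵖ)ᵒᵖ

/-! ### Points of a finite modal algebra -/

section Points

variable {A : Type u} {B : Type v} [ModalAlgebra A] [ModalAlgebra B]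

/-! The points of a finite modal algebra (its homomorphisms to `Prop`, in effect its atoms) form a
finite frame under `pointRel`. They separate elements, and every set of points comes from an
element, so `specFunctor` is fully faithful on `FinModAlgᵒᵖ`. Every finite frame lies in its
essential image, being dual to its algebra of subsets. It remains to see that the locally finite
frames are the Ind-completion of the finite ones.

The comparison is the restricted Yoneda functor `finNerve`. It is fully faithful because each point
lies in a finite generated subframe, so maps out of a locally finite frame are glued from maps out
of finite frames. Filtered colimits of locally finite frames are computed on underlying sets, and
finite frames are compact for them (`IsFilteredUnion.exists_factor`,
`IsFilteredUnion.exists_comp_eq`), so `finNerve` preserves them. Its values are ind-objects since a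
locally finite frame is the directed union of its finite upsets, and every ind-object arises as the
nerve of a colimit of dual frames. -/

theorem ModalAlgebra.dia_mono : Monotone (ModalAlgebra.dia : A → A) := by
  intro a b h
  rw [← sup_eq_right] at h ⊢
  rw [← ModalAlgebra.dia_sup, h]

/-- The homomorphism to `Prop` given by a join-prime, non-bottom element. -/
def pointOfPrime {A : Type u} [BooleanAlgebra A] (e : A) (he : e ≠ ⊥)
    (hp : ∀ a b, e ≤ a ⊔ b → e ≤ a ∨ e ≤ b) : BoundedLatticeHom A Prop where
  toFun a := e ≤ a
  map_sup' a b := propext ⟨hp a b, fun h => h.elim le_sup_of_le_left le_sup_of_le_right⟩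
  map_inf' _ _ := propext le_inf_iff
  map_top' := eq_true le_top
  map_bot' := eq_false fun h => he (le_bot_iff.mp h)

section Boolean

variable {A : Type u} [BooleanAlgebra A]

theorem point_sup (x : BoundedLatticeHom A Prop) (a b : A) : x (a ⊔ b) ↔ x a ∨ x b := by
  rw [map_sup]; rfl

theorem point_inf (x : BoundedLatticeHom A Prop) (a b : A) : x (a ⊓ b) ↔ x a ∧ x b := by
  rw [map_inf]; rfl

theorem point_bot (x : BoundedLatticeHom A Prop) : ¬ x ⊥ := by
  rw [map_bot]; exact id

theorem point_top (x : BoundedLatticeHom A Prop) : x ⊤ := by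
  rw [map_top]; trivial

theorem point_mono (x : BoundedLatticeHom A Prop) {a b : A} (h : a ≤ b) (ha : x a) : x b := by
  rw [← sup_eq_right.mpr h, point_sup]; exact Or.inl ha

theorem point_compl (x : BoundedLatticeHom A Prop) (a : A) : x aᶜ ↔ ¬ x a := by
  constructor
  · intro h h'
    exact point_bot x (inf_compl_eq_bot (a := a) ▸ (point_inf x a aᶜ).mpr ⟨h', h⟩)
  · intro h
    exact ((point_sup x a aᶜ).mp (sup_compl_eq_top (x := a) ▸ point_top x)).resolve_left h

/-- If one point is contained in another one, then they agree. -/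
theorem point_eq_of_le {x y : BoundedLatticeHom A Prop} (h : ∀ a, x a → y a) : x = y := by
  refine DFunLike.ext _ _ fun a => propext ⟨h a, fun hy => ?_⟩
  by_contra hx
  exact (point_compl y a).mp (h _ ((point_compl x a).mpr hx)) hy

/-- A prime, monotone predicate holding at `c` but not at `⊥` is witnessed by a point of `c`. -/
theorem exists_point_of_prime [Finite A] (p : A → Prop) (hbot : ¬ p ⊥)
    (hp : ∀ a b, p (a ⊔ b) → p a ∨ p b) (hmono : ∀ a b, a ≤ b → p a → p b) (c : A) (hc : p c) :
    ∃ x : BoundedLatticeHom A Prop, x c ∧ ∀ a, x a → p a := by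
  obtain ⟨e, hec, he⟩ := (Set.toFinite {a | p a}).exists_le_minimal hc
  -- Splitting `e` along `a` and its complement, primeness gives `p` on one of the parts, and
  -- minimality makes that part all of `e`.
  have key : ∀ a, e ≤ a ∨ e ≤ aᶜ := by
    intro a
    have h : p (e ⊓ a ⊔ e ⊓ aᶜ) := by
      rw [← inf_sup_left, sup_compl_eq_top, inf_top_eq]; exact he.prop
    rcases hp _ _ h with h | h
    · exact Or.inl ((he.le_of_le h inf_le_left).trans inf_le_right)
    · exact Or.inr ((he.le_of_le h inf_le_left).trans inf_le_right)
  refine ⟨pointOfPrime e ?_ ?_, hec, fun a ha => hmono _ _ ha he.prop⟩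
  · rintro rfl; exact hbot he.prop
  · intro a b h
    refine (key a).imp_right fun h' => ?_
    calc e ≤ (a ⊔ b) ⊓ aᶜ := le_inf h h'
      _ ≤ b := by rw [inf_sup_right, inf_compl_eq_bot, bot_sup_eq]; exact inf_le_left

theorem exists_point [Finite A] (c : A) (hc : c ≠ ⊥) : ∃ x : BoundedLatticeHom A Prop, x c := by
  obtain ⟨x, hx, -⟩ := exists_point_of_prime (fun a : A => a ≠ ⊥) (by simp)
    (fun a b h => by simpa [or_iff_not_imp_left] using h)
    (fun a b h ha hb => ha (le_bot_iff.mp (hb ▸ h))) c hc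
  exact ⟨x, hx⟩

theorem le_of_forall_point [Finite A] {a b : A}
    (h : ∀ x : BoundedLatticeHom A Prop, x a → x b) : a ≤ b := by
  by_contra hab
  obtain ⟨x, hx⟩ := exists_point (a ⊓ bᶜ) (by rwa [Ne, ← sdiff_eq, sdiff_eq_bot_iff])
  rw [point_inf, point_compl] at hx
  exact hx.2 (h x hx.1)

theorem eq_of_forall_point [Finite A] {a b : A}
    (h : ∀ x : BoundedLatticeHom A Prop, x a ↔ x b) : a = b :=
  le_antisymm (le_of_forall_point fun x => (h x).mp) (le_of_forall_point fun x => (h x).mpr)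

/-- The least element of a point of a finite Boolean algebra. -/
theorem exists_least [Finite A] (x : BoundedLatticeHom A Prop) : ∃ e, ∀ a, x a ↔ e ≤ a := by
  obtain ⟨e, he⟩ := (Set.toFinite {a | x a}).exists_minimal ⟨⊤, point_top x⟩
  exact ⟨e, fun a => ⟨fun h => (he.le_of_le ((point_inf x e a).mpr ⟨he.prop, h⟩)
    inf_le_left).trans inf_le_right, fun h => point_mono x h he.prop⟩⟩

/-- To add a point `y` to the set, join its least element `e`: a point containing `e` contains `y`,
hence equals `y`. -/
theorem exists_element [Finite A] (S : Set (BoundedLatticeHom A Prop)) :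
    ∃ a : A, ∀ x : BoundedLatticeHom A Prop, x a ↔ x ∈ S := by
  have : Finite (BoundedLatticeHom A Prop) := DFunLike.finite _
  refine S.toFinite.induction_on (motive := fun S _ => ∃ a : A, ∀ x, x a ↔ x ∈ S) S
    ⟨⊥, fun x => by simp⟩ ?_
  rintro y T - - ⟨a, ha⟩
  obtain ⟨e, he⟩ := exists_least y
  refine ⟨e ⊔ a, fun x => ?_⟩
  rw [point_sup, ha, Set.mem_insert_iff]
  refine or_congr_left ⟨fun h => ?_, fun h => h ▸ (he e).mpr le_rfl⟩
  exact (point_eq_of_le fun b hb => point_mono x ((he b).mp hb) h).symm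

end Boolean

/-- The accessibility relation between points of a modal algebra. -/
def pointRel (x y : BoundedLatticeHom A Prop) : Prop :=
  ∀ a, y a → x (ModalAlgebra.dia a)

/-- The dual frame of a modal algebra. -/
abbrev spec (A : Type u) [ModalAlgebra A] : KripkeFrame.{u} where
  carrier := BoundedLatticeHom A Prop
  rel := pointRel

/-- Since `dia` preserves finite joins, `a ↦ x (dia a)` is prime, monotone and false at `⊥`; the
points below this predicate are exactly the successors of `x`. -/
theorem point_dia [Finite A] (x : BoundedLatticeHom A Prop) (c : A) :
    x (ModalAlgebra.dia c) ↔ ∃ y : BoundedLatticeHom A Prop, pointRel x y ∧ y c := by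
  constructor
  · intro h
    obtain ⟨y, hy, hyx⟩ := exists_point_of_prime (fun a => x (ModalAlgebra.dia a))
      (by simp only [ModalAlgebra.dia_bot]; exact point_bot x)
      (fun a b => by simp only [ModalAlgebra.dia_sup]; exact (point_sup x _ _).mp)
      (fun a b hab => point_mono x (ModalAlgebra.dia_mono hab)) c h
    exact ⟨y, hyx, hy⟩
  · rintro ⟨y, hxy, hy⟩
    exact hxy c hy

/-- The p-morphism dual to a morphism of finite modal algebras. -/
noncomputable def specMap [Finite A] [Finite B] (f : ModalHom A B) :
    PMorphism (spec B) (spec A) where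
  toFun x := BoundedLatticeHom.comp x f.toHom
  stable x y h a ha := by
    change x (f.toHom (ModalAlgebra.dia a))
    rw [f.map_dia]
    exact h _ ha
  isOpen x y h := by
    -- A successor `z` of `x` containing the image of `e` restricts to a point containing `y`, hence
    -- to `y` itself.
    obtain ⟨e, he⟩ := exists_least y
    have h1 : x (f.toHom (ModalAlgebra.dia e)) := h e ((he e).mpr le_rfl)
    rw [f.map_dia, point_dia] at h1
    obtain ⟨z, hxz, hz⟩ := h1
    refine ⟨z, hxz, (point_eq_of_le (x := y) (y := z.comp f.toHom) fun a ha => ?_).symm⟩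
    exact point_mono z (OrderHomClass.mono f.toHom ((he a).mp ha)) hz

theorem specMap_injective [Finite A] [Finite B] {f g : ModalHom A B}
    (h : specMap f = specMap g) : f = g := by
  ext a
  refine eq_of_forall_point fun x => ?_
  have := congrArg (fun k => DFunLike.coe (F := BoundedLatticeHom A Prop) (k.toFun x) a) h
  exact this.to_iff

/-- The preimage of `a` is sent to the element whose points are those that `g` maps to points of
`a`. Compatibility with `dia` is read off from `point_dia`: openness of `g` gives one implication,
stability the other. -/
theorem specMap_surjective [Finite A] [Finite B] (g : PMorphism (spec B) (spec A)) :
    ∃ f : ModalHom A B, specMap f = g := by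
  let g' : BoundedLatticeHom B Prop → BoundedLatticeHom A Prop := g.toFun
  choose f hf using fun a : A => exists_element {x : BoundedLatticeHom B Prop | g' x a}
  simp only [Set.mem_ofPred_eq] at hf
  refine ⟨⟨⟨⟨⟨f, ?_⟩, ?_⟩, ?_, ?_⟩, ?_⟩, ?_⟩
  · intro a b
    exact eq_of_forall_point fun x => by simp only [hf, point_sup]
  · intro a b
    exact eq_of_forall_point fun x => by
      rw [point_inf]
      simp only [hf, point_inf]
  · exact eq_of_forall_point fun x => (hf _ x).trans (by simp only [point_top])
  · exact eq_of_forall_point fun x => (hf _ x).trans (by simp only [point_bot])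
  · intro a
    refine eq_of_forall_point fun x => (hf _ x).trans ?_
    change g' x (ModalAlgebra.dia a) ↔ x (ModalAlgebra.dia (f a))
    rw [point_dia, point_dia]
    constructor
    · rintro ⟨y, hxy, hy⟩
      obtain ⟨z, hz, rfl⟩ := g.isOpen x y hxy
      exact ⟨z, hz, (hf a z).mpr hy⟩
    · rintro ⟨z, hz, hza⟩
      exact ⟨g' z, g.stable _ _ hz, (hf a z).mp hza⟩
  · exact PMorphism.ext (funext fun x => DFunLike.ext (F := BoundedLatticeHom A Prop) _ _
      fun a => propext (hf a x))

end Points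

/-! ### Finite frames as dual frames -/

/-- The modal algebra of all subsets of a Kripke frame. -/
abbrev KripkeFrame.complexAlgebra (K : KripkeFrame.{u}) : ModalAlgebra (Set K.carrier) where
  dia S := {k | ∃ l ∈ S, K.rel k l}
  dia_sup a b := by ext k; simp [or_and_right, exists_or]
  dia_bot := by ext k; simp

/-- A finite Kripke frame embeds into the dual frame of its algebra of subsets. -/
def KripkeFrame.toSpec (K : KripkeFrame.{u}) :
    K.carrier → (@spec (Set K.carrier) K.complexAlgebra).carrier := fun k =>
  { toFun := fun S => k ∈ S
    map_sup' := fun _ _ => rfl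
    map_inf' := fun _ _ => rfl
    map_top' := rfl
    map_bot' := rfl }

theorem KripkeFrame.toSpec_bijective (K : KripkeFrame.{u}) [Finite K.carrier] :
    Function.Bijective K.toSpec := by
  constructor
  · intro k l h
    have := congrArg (fun x : BoundedLatticeHom (Set K.carrier) Prop => x {l}) h
    exact this.mpr rfl
  · intro x
    let x' : BoundedLatticeHom (Set K.carrier) Prop := x
    obtain ⟨e, he⟩ := exists_least x'
    have hne : e.Nonempty := by
      rw [Set.nonempty_iff_ne_empty]
      rintro rfl
      exact point_bot x' ((he _).mpr le_rfl)
    obtain ⟨k, hk⟩ := hne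
    -- Any `k` in the least member `e` works: the principal point at `k` contains `x`, hence equals
    -- it.
    exact ⟨k, (point_eq_of_le (x := x') fun a ha => (he a).mp ha hk).symm⟩

theorem KripkeFrame.toSpec_rel_iff (K : KripkeFrame.{u}) (k l : K.carrier) :
    (@spec (Set K.carrier) K.complexAlgebra).rel (K.toSpec k) (K.toSpec l) ↔ K.rel k l := by
  constructor
  · intro h
    obtain ⟨m, hm, hkm⟩ := h {l} (Set.mem_singleton l)
    rwa [← Set.mem_singleton_iff.mp hm]
  · intro h a ha
    exact ⟨l, ha, h⟩

open Limits Opposite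

/-! ### Locally finite frames and generated subframes -/

namespace LFKripkeFrame

/-- The underlying function of a morphism of locally finite Kripke frames. -/
def fn {P Q : LFKripkeFrame.{u}} (f : P ⟶ Q) : P.obj.carrier → Q.obj.carrier := f.hom.toFun

theorem fn_comp {P Q T : LFKripkeFrame.{u}} (f : P ⟶ Q) (g : Q ⟶ T) (p : P.obj.carrier) :
    fn (f ≫ g) p = fn g (fn f p) := rfl

theorem fn_id {P : LFKripkeFrame.{u}} (p : P.obj.carrier) : fn (𝟙 P) p = p := rfl

theorem hom_ext {P Q : LFKripkeFrame.{u}} {f g : P ⟶ Q} (h : ∀ p, fn f p = fn g p) : f = g :=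
  ObjectProperty.hom_ext _ (PMorphism.ext (funext h))

theorem stable {P Q : LFKripkeFrame.{u}} (f : P ⟶ Q) {p p' : P.obj.carrier}
    (h : P.obj.rel p p') : Q.obj.rel (fn f p) (fn f p') := f.hom.stable p p' h

theorem isOpen {P Q : LFKripkeFrame.{u}} (f : P ⟶ Q) {p : P.obj.carrier} {q : Q.obj.carrier}
    (h : Q.obj.rel (fn f p) q) : ∃ p', P.obj.rel p p' ∧ fn f p' = q := f.hom.isOpen p q h

/-- A p-morphism seen as a morphism of locally finite Kripke frames. -/
def ofPMorphism {P Q : LFKripkeFrame.{u}} (f : PMorphism P.obj Q.obj) : P ⟶ Q :=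
  ObjectProperty.homMk f

/-- A bijection preserving and reflecting the relation is an isomorphism. -/
noncomputable def isoOfBijective {P Q : LFKripkeFrame.{u}} (f : P.obj.carrier → Q.obj.carrier)
    (hf : Function.Bijective f) (hrel : ∀ p p', Q.obj.rel (f p) (f p') ↔ P.obj.rel p p') :
    P ≅ Q where
  hom := ofPMorphism ⟨f, fun p p' => (hrel p p').mpr, fun p q h => by
    obtain ⟨p', rfl⟩ := hf.surjective q
    exact ⟨p', (hrel p p').mp h, rfl⟩⟩
  inv := ofPMorphism ⟨(Equiv.ofBijective f hf).symm, fun q q' h => by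
      obtain ⟨p, rfl⟩ := hf.surjective q
      obtain ⟨p', rfl⟩ := hf.surjective q'
      rw [Equiv.ofBijective_symm_apply_apply, Equiv.ofBijective_symm_apply_apply]
      exact (hrel p p').mp h,
    fun q p' h => by
      obtain ⟨p, rfl⟩ := hf.surjective q
      rw [Equiv.ofBijective_symm_apply_apply] at h
      exact ⟨f p', (hrel p p').mpr h, Equiv.ofBijective_symm_apply_apply f hf p'⟩⟩
  hom_inv_id := hom_ext fun p => Equiv.ofBijective_symm_apply_apply f hf p
  inv_hom_id := hom_ext fun q => Equiv.ofBijective_apply_symm_apply f hf q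

theorem finite_successors (P : LFKripkeFrame.{u}) (p : P.obj.carrier) :
    Finite {q // P.obj.rel p q} :=
  ((P.property p).subset fun _ h => Relation.ReflTransGen.single h : {q | P.obj.rel p q}.Finite)

/-- A subset closed under successors, as a frame. -/
def upset (P : LFKripkeFrame.{u}) (S : Set P.obj.carrier) : LFKripkeFrame.{u} where
  obj := ⟨S, fun x y => P.obj.rel x y⟩
  property p := by
    refine Set.Finite.of_finite_image (f := Subtype.val) ((P.property p.1).subset ?_)
      Subtype.val_injective.injOn
    rintro _ ⟨q, hq, rfl⟩
    exact Relation.ReflTransGen.lift Subtype.val (fun _ _ h => h) _ _ hq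

/-- The inclusion between two subsets closed under successors. -/
def upsetMap {P : LFKripkeFrame.{u}} {S T : Set P.obj.carrier}
    (hS : ∀ x ∈ S, ∀ y, P.obj.rel x y → y ∈ S) (h : S ⊆ T) : P.upset S ⟶ P.upset T :=
  ofPMorphism ⟨Set.inclusion h, fun _ _ h => h,
    fun x y hxy => ⟨⟨y.1, hS x.1 x.2 y.1 hxy⟩, hxy, rfl⟩⟩

/-- The inclusion of a subset closed under successors. -/
def upsetι (P : LFKripkeFrame.{u}) (S : Set P.obj.carrier)
    (hS : ∀ x ∈ S, ∀ y, P.obj.rel x y → y ∈ S) : P.upset S ⟶ P :=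
  ofPMorphism ⟨Subtype.val, fun _ _ h => h, fun x y hxy => ⟨⟨y, hS x.1 x.2 y hxy⟩, hxy, rfl⟩⟩

/-- The set of points reachable from a given one. -/
def reach (P : LFKripkeFrame.{u}) (p : P.obj.carrier) : Set P.obj.carrier :=
  {q | Relation.ReflTransGen P.obj.rel p q}

theorem reach_closed (P : LFKripkeFrame.{u}) (p : P.obj.carrier) :
    ∀ x ∈ P.reach p, ∀ y, P.obj.rel x y → y ∈ P.reach p :=
  fun _ hx _ hxy => Relation.ReflTransGen.tail hx hxy

theorem finite_reach (P : LFKripkeFrame.{u}) (p : P.obj.carrier) : (P.reach p).Finite :=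
  P.property p

theorem mem_reach (P : LFKripkeFrame.{u}) (p : P.obj.carrier) : p ∈ P.reach p :=
  Relation.ReflTransGen.refl

/-- A morphism restricts to the subframes generated by a point and by its image. -/
def reachMap {P Q : LFKripkeFrame.{u}} (f : P ⟶ Q) (p : P.obj.carrier) :
    P.upset (P.reach p) ⟶ Q.upset (Q.reach (fn f p)) :=
  ofPMorphism ⟨fun x => ⟨fn f x.1, Relation.ReflTransGen.lift (fn f) (fun _ _ => stable f) _ _ x.2⟩,
    fun _ _ h => stable f h, fun x y h => by
      obtain ⟨z, hz, hzy⟩ := isOpen f h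
      exact ⟨⟨z, P.reach_closed p x.1 x.2 z hz⟩, hz, Subtype.ext hzy⟩⟩

theorem reachMap_comp {P Q : LFKripkeFrame.{u}} (f : P ⟶ Q) (p : P.obj.carrier) :
    reachMap f p ≫ Q.upsetι _ (Q.reach_closed _) = P.upsetι _ (P.reach_closed p) ≫ f := rfl

/-! ### Filtered colimits -/

section Colimits

variable {J : Type u} [SmallCategory J]

/-- In a filtered category, finitely many properties of arrows out of an object that are stable
under composition and satisfied by some arrow are satisfied simultaneously. -/
theorem exists_forall_of_finite [IsFiltered J] {j : J} {ι : Type*} [Finite ι] (p : ι → ∀ k, (j ⟶ k) → Prop)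
    (hp : ∀ i k f l (g : k ⟶ l), p i k f → p i l (f ≫ g)) (h : ∀ i, ∃ k f, p i k f) :
    ∃ k f, ∀ i, p i k f := by
  suffices H : ∀ s : Set ι, s.Finite → ∃ k f, ∀ i ∈ s, p i k f by
    obtain ⟨k, f, hf⟩ := H Set.univ Set.finite_univ
    exact ⟨k, f, fun i => hf i trivial⟩
  intro s hs
  refine hs.induction_on (motive := fun s _ => ∃ k f, ∀ i ∈ s, p i k f) s
    ⟨j, 𝟙 j, fun i hi => hi.elim⟩ ?_
  rintro i t - - ⟨k, f, hf⟩
  obtain ⟨k', f', hf'⟩ := h i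
  obtain ⟨l, g, g', e⟩ := IsFiltered.span f f'
  refine ⟨l, f ≫ g, fun i' hi' => ?_⟩
  rcases Set.mem_insert_iff.mp hi' with rfl | hi'
  · exact e ▸ hp _ _ _ _ g' hf'
  · exact hp _ _ _ _ g (hf i' hi')

variable {K : J ⥤ LFKripkeFrame.{u}}

/-- The cocone is a filtered colimit on the level of underlying sets. -/
structure IsFilteredUnion (c : Cocone K) : Prop where
  surj : ∀ p : c.pt.obj.carrier, ∃ j x, fn (c.ι.app j) x = p
  inj : ∀ j x y, fn (c.ι.app j) x = fn (c.ι.app j) y →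
    ∃ (k : J) (f : j ⟶ k), fn (K.map f) x = fn (K.map f) y

theorem fn_w (c : Cocone K) {j k : J} (f : j ⟶ k) (x : (K.obj j).obj.carrier) :
    fn (c.ι.app k) (fn (K.map f) x) = fn (c.ι.app j) x := by
  rw [← fn_comp, c.w]

theorem fn_map_comp {j k l : J} (f : j ⟶ k) (g : k ⟶ l) (x : (K.obj j).obj.carrier) :
    fn (K.map (f ≫ g)) x = fn (K.map g) (fn (K.map f) x) := by
  rw [K.map_comp]; rfl

variable {c : Cocone K} (hc : IsFilteredUnion c) {N : LFKripkeFrame.{u}} [Finite N.obj.carrier]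
include hc

theorem IsFilteredUnion.exists_comp_eq [IsFiltered J] {j : J} (g h : N ⟶ K.obj j)
    (e : g ≫ c.ι.app j = h ≫ c.ι.app j) : ∃ (k : J) (f : j ⟶ k), g ≫ K.map f = h ≫ K.map f := by
  obtain ⟨k, f, hf⟩ := exists_forall_of_finite (ι := N.obj.carrier)
    (fun n k (f : j ⟶ k) => fn (K.map f) (fn g n) = fn (K.map f) (fn h n))
    (fun n k f l f' hf => by simp only [fn_map_comp, hf])
    (fun n => hc.inj j _ _ (congrArg (fun m => fn m n) e))
  exact ⟨k, f, hom_ext hf⟩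

theorem IsFilteredUnion.exists_factor_fun [IsFiltered J] (m : N.obj.carrier → c.pt.obj.carrier) :
    ∃ (j : J) (g : N.obj.carrier → (K.obj j).obj.carrier), ∀ n, fn (c.ι.app j) (g n) = m n := by
  classical
  choose j x hx using fun n => hc.surj (m n)
  obtain ⟨k, hk⟩ := IsFiltered.sup_objs_exists (Set.finite_range j).toFinset
  have hk' : ∀ n, Nonempty (j n ⟶ k) := fun n => hk (by simp)
  exact ⟨k, fun n => fn (K.map (hk' n).some) (x n), fun n => by rw [fn_w, hx]⟩

/-- `IsFilteredUnion` speaks of points only; relations descend to a finite stage because the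
coprojections are open. -/
theorem IsFilteredUnion.exists_rel {j : J} {x y : (K.obj j).obj.carrier}
    (h : c.pt.obj.rel (fn (c.ι.app j) x) (fn (c.ι.app j) y)) :
    ∃ (k : J) (f : j ⟶ k), (K.obj k).obj.rel (fn (K.map f) x) (fn (K.map f) y) := by
  obtain ⟨z, hz, hzy⟩ := isOpen (c.ι.app j) h
  obtain ⟨k, f, hf⟩ := hc.inj j z y hzy
  exact ⟨k, f, hf ▸ stable (K.map f) hz⟩

/-- Compactness of finite frames. A lift of the underlying function exists at some stage; moving
further along makes it stable (finitely many related pairs), then open (finitely many successors of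
the lifted points). -/
theorem IsFilteredUnion.exists_factor [IsFiltered J] (m : N ⟶ c.pt) :
    ∃ (j : J) (g : N ⟶ K.obj j), g ≫ c.ι.app j = m := by
  obtain ⟨j, g, hg⟩ := hc.exists_factor_fun (fn m)
  obtain ⟨k, f, hf⟩ := exists_forall_of_finite
    (ι := {n : N.obj.carrier × N.obj.carrier // N.obj.rel n.1 n.2})
    (fun n k (f : j ⟶ k) => (K.obj k).obj.rel (fn (K.map f) (g n.1.1)) (fn (K.map f) (g n.1.2)))
    (fun n k f l f' hf => by simp only [fn_map_comp]; exact stable _ hf)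
    (fun n => hc.exists_rel (by rw [hg, hg]; exact stable m n.2))
  -- Local finiteness of the stage is what leaves only finitely many openness conditions.
  have (n : N.obj.carrier) : Finite {v // (K.obj k).obj.rel (fn (K.map f) (g n)) v} :=
    finite_successors _ _
  obtain ⟨l, f', hf'⟩ := exists_forall_of_finite
    (ι := Σ n : N.obj.carrier, {v // (K.obj k).obj.rel (fn (K.map f) (g n)) v})
    (fun n l (f' : k ⟶ l) => ∃ n', N.obj.rel n.1 n' ∧
      fn (K.map f') (fn (K.map f) (g n')) = fn (K.map f') n.2.1)
    (fun n l f' l' f'' ⟨n', hn, h⟩ => ⟨n', hn, by simp only [fn_map_comp, h]⟩)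
    (fun n => by
      have h := stable (c.ι.app k) n.2.2
      rw [fn_w, hg] at h
      obtain ⟨n', hn', h'⟩ := isOpen m h
      obtain ⟨l, f', hf'⟩ := hc.inj k (fn (K.map f) (g n')) n.2.1 (by rw [fn_w, hg, h'])
      exact ⟨l, f', n', hn', hf'⟩)
  refine ⟨l, ofPMorphism ⟨fun n => fn (K.map f') (fn (K.map f) (g n)),
    fun n n' h => stable _ (hf ⟨(n, n'), h⟩), fun n q h => ?_⟩, hom_ext fun n => ?_⟩
  -- Passing to stage `l` creates no new conditions: by openness of the transition map, successors
  -- there come from successors at stage `k`.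
  · obtain ⟨v, hv, rfl⟩ := isOpen (K.map f') h
    exact hf' ⟨n, v, hv⟩
  · change fn (c.ι.app l) (fn (K.map f') (fn (K.map f) (g n))) = _
    rw [fn_w, fn_w, hg]

end Colimits

/-! ### Construction of filtered colimits -/

section Construction

/-- The underlying set functor. -/
def points : LFKripkeFrame.{u} ⥤ Type u where
  obj P := P.obj.carrier
  map f := ↾(fn f)

variable {J : Type u} [SmallCategory J] (K : J ⥤ LFKripkeFrame.{u})

/-- The coprojections on the colimit of the underlying sets. -/
noncomputable def colimitIn (j : J) (x : (K.obj j).obj.carrier) : (colimit (K ⋙ points) : Type u) :=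
  colimit.ι (K ⋙ points) j x

theorem colimitIn_surj (p : (colimit (K ⋙ points) : Type u)) : ∃ j x, colimitIn K j x = p :=
  Types.jointly_surjective' p

theorem colimitIn_w {j k : J} (f : j ⟶ k) (x : (K.obj j).obj.carrier) :
    colimitIn K k (fn (K.map f) x) = colimitIn K j x :=
  colimit.w_apply (K ⋙ points) f x

variable [IsFiltered J]

theorem colimitIn_eq_iff {j k : J} {x : (K.obj j).obj.carrier} {y : (K.obj k).obj.carrier} :
    colimitIn K j x = colimitIn K k y ↔
      ∃ (l : J) (f : j ⟶ l) (g : k ⟶ l), fn (K.map f) x = fn (K.map g) y :=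
  Types.FilteredColimit.colimit_eq_iff (K ⋙ points)

/-- The filtered colimit of a diagram of locally finite frames, as a frame. -/
noncomputable def colimitFrame : KripkeFrame.{u} where
  carrier := (colimit (K ⋙ points) : Type u)
  rel p q := ∃ j x y, (K.obj j).obj.rel x y ∧ colimitIn K j x = p ∧ colimitIn K j y = q

/-- The coprojections are p-morphisms. -/
noncomputable def colimitInHom (j : J) : PMorphism (K.obj j).obj (colimitFrame K) where
  toFun := colimitIn K j
  stable x y h := ⟨j, x, y, h, rfl, rfl⟩
  isOpen x q := by
    rintro ⟨k, x', y, h, hx, rfl⟩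
    -- The relation is pushed to a common stage `l`, then pulled back to `j` by openness of `K.map
    -- g`.
    obtain ⟨l, f, g, e⟩ := (colimitIn_eq_iff K).mp hx
    have h' := stable (K.map f) h
    rw [e] at h'
    obtain ⟨z, hz, hzy⟩ := isOpen _ h'
    exact ⟨z, hz, by rw [← colimitIn_w K g, hzy, colimitIn_w]⟩

/-- Openness of the coprojections puts everything reachable from the class of `x` in the image of
the finite set reachable from `x`. -/
theorem colimitFrame_isLocallyFinite : (colimitFrame K).IsLocallyFinite := by
  intro p
  obtain ⟨j, x, rfl⟩ := colimitIn_surj K p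
  refine ((finite_reach _ x).image (colimitIn K j)).subset fun q hq => ?_
  induction hq with
  | refl => exact ⟨x, mem_reach _ x, rfl⟩
  | tail _ h ih =>
    obtain ⟨y, hy, rfl⟩ := ih
    obtain ⟨z, hz, rfl⟩ := (colimitInHom K j).isOpen y _ h
    exact ⟨z, reach_closed _ x y hy z hz, rfl⟩

/-- The colimit cocone of a filtered diagram of locally finite frames. -/
noncomputable def colimitCocone : Cocone K where
  pt := ⟨colimitFrame K, colimitFrame_isLocallyFinite K⟩
  ι :=
    { app j := ofPMorphism (colimitInHom K j)
      naturality _ _ f := hom_ext fun x => colimitIn_w K f x }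

theorem colimitCocone_isFilteredUnion : IsFilteredUnion (colimitCocone K) where
  surj := colimitIn_surj K
  inj j x y h := by
    obtain ⟨l, f, g, e⟩ := (colimitIn_eq_iff K).mp h
    -- The equality so far involves two parallel arrows, which must be merged into one.
    obtain ⟨m, q, hq⟩ := IsFilteredOrEmpty.cocone_maps f g
    exact ⟨m, f ≫ q, by rw [fn_map_comp, e, ← fn_map_comp, hq]⟩

end Construction

end LFKripkeFrame

/-! ### Finite duality and the nerve functor -/

open Limits Opposite

instance (A : FinModAlg.{u}) : Finite A.obj.carrier := A.property

/-- The dual frame functor on finite modal algebras. -/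
noncomputable def specFunctor : FinModAlg.{u}ᵒᵖ ⥤ LFKripkeFrame.{u} where
  obj A := ⟨spec A.unop.obj.carrier, fun _ =>
    have : Finite (BoundedLatticeHom A.unop.obj.carrier Prop) := DFunLike.finite _
    Set.toFinite _⟩
  map f := LFKripkeFrame.ofPMorphism (specMap f.unop.hom)
  map_id _ := rfl
  map_comp _ _ := rfl

instance : (specFunctor.{u}).Faithful where
  map_injective h := Quiver.Hom.unop_inj (ObjectProperty.hom_ext _
    (specMap_injective (congrArg InducedCategory.Hom.hom h)))

instance : (specFunctor.{u}).Full where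
  map_surjective g := by
    obtain ⟨f, hf⟩ := specMap_surjective g.hom
    exact ⟨Quiver.Hom.op (ObjectProperty.homMk f), ObjectProperty.hom_ext _ hf⟩

instance (A : FinModAlg.{u}ᵒᵖ) : Finite (specFunctor.obj A).obj.carrier :=
  show Finite (BoundedLatticeHom A.unop.obj.carrier Prop) from DFunLike.finite _

theorem mem_essImage_specFunctor (K : LFKripkeFrame.{u}) (hK : Finite K.obj.carrier) :
    specFunctor.essImage K :=
  ⟨op ⟨@ModAlg.mk (Set K.obj.carrier) K.obj.complexAlgebra,
      inferInstanceAs (Finite (Set K.obj.carrier))⟩,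
    ⟨(LFKripkeFrame.isoOfBijective K.obj.toSpec K.obj.toSpec_bijective K.obj.toSpec_rel_iff).symm⟩⟩

/-- The presheaf on (the opposite of) finite modal algebras represented by a locally finite
frame. -/
noncomputable def finNerve : LFKripkeFrame.{u} ⥤ FinModAlg.{u}ᵒᵖᵒᵖ ⥤ Type u :=
  yoneda ⋙ (Functor.whiskeringLeft _ _ _).obj specFunctor.op

/-! ### The nerve is fully faithful -/

namespace LFKripkeFrame

variable {P Q : LFKripkeFrame.{u}}

/-- The action of a transformation between nerves on a map from a finite frame. -/
def nerveApp (α : finNerve.obj P ⟶ finNerve.obj Q) {A : FinModAlg.{u}ᵒᵖ}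
    (h : specFunctor.obj A ⟶ P) : specFunctor.obj A ⟶ Q :=
  α.app (op A) h

/-- Fullness of `specFunctor` makes naturality available along every p-morphism of dual frames. -/
theorem nerveApp_comp (α : finNerve.obj P ⟶ finNerve.obj Q) {A B : FinModAlg.{u}ᵒᵖ}
    (k : specFunctor.obj B ⟶ specFunctor.obj A) (h : specFunctor.obj A ⟶ P) :
    nerveApp α (k ≫ h) = k ≫ nerveApp α h := by
  obtain ⟨f, rfl⟩ := specFunctor.map_surjective k
  exact ConcreteCategory.congr_hom (α.naturality f.op) h

/-- The subframe generated by a point. -/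
abbrev gen (P : LFKripkeFrame.{u}) (p : P.obj.carrier) : LFKripkeFrame.{u} := P.upset (P.reach p)

/-- The point `p` of the subframe that it generates. -/
def genPoint (P : LFKripkeFrame.{u}) (p : P.obj.carrier) : (P.gen p).obj.carrier :=
  ⟨p, P.mem_reach p⟩

/-- The inclusion of the subframe generated by a point. -/
abbrev genι (P : LFKripkeFrame.{u}) (p : P.obj.carrier) : P.gen p ⟶ P :=
  P.upsetι _ (P.reach_closed p)

theorem gen_mem_essImage (P : LFKripkeFrame.{u}) (p : P.obj.carrier) :
    specFunctor.essImage (P.gen p) :=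
  mem_essImage_specFunctor _ (P.finite_reach p).to_subtype

/-- The frame generated by a point, up to isomorphism the dual frame of a finite modal algebra. -/
noncomputable def genIso (P : LFKripkeFrame.{u}) (p : P.obj.carrier) :
    specFunctor.obj (P.gen_mem_essImage p).witness ≅ P.gen p :=
  (P.gen_mem_essImage p).getIso

/-- The extension of a transformation between nerves to the maps out of generated subframes. -/
noncomputable def nerveGen (α : finNerve.obj P ⟶ finNerve.obj Q) (p : P.obj.carrier) : P.gen p ⟶ Q :=
  (P.genIso p).inv ≫ nerveApp α ((P.genIso p).hom ≫ P.genι p)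

/-- The function underlying the morphism that induces a transformation between nerves. -/
noncomputable def nerveFun (α : finNerve.obj P ⟶ finNerve.obj Q) (p : P.obj.carrier) : Q.obj.carrier :=
  fn (nerveGen α p) (P.genPoint p)

/-- The value at `x` depends only on `fn h x`: on the subframe generated by `x`, the map `h` factors
through the one generated by `fn h x`, and naturality applies. -/
theorem fn_nerveApp (α : finNerve.obj P ⟶ finNerve.obj Q) {A : FinModAlg.{u}ᵒᵖ}
    (h : specFunctor.obj A ⟶ P) (x : (specFunctor.obj A).obj.carrier) :
    fn (nerveApp α h) x = nerveFun α (fn h x) := by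
  let N := specFunctor.obj A
  have e : (N.genIso x).hom ≫ N.genι x ≫ nerveApp α h =
      (N.genIso x).hom ≫ reachMap h x ≫ nerveGen α (fn h x) := by
    rw [← Category.assoc, ← nerveApp_comp, Category.assoc, ← reachMap_comp]
    have := nerveApp_comp α
      ((N.genIso x).hom ≫ reachMap h x ≫ (P.genIso (fn h x)).inv)
      ((P.genIso (fn h x)).hom ≫ P.genι (fn h x))
    simpa [nerveGen] using this
  rw [Iso.cancel_iso_hom_left] at e
  exact congrArg (fun k => fn k (N.genPoint x)) e

theorem fn_nerveGen (α : finNerve.obj P ⟶ finNerve.obj Q) (p : P.obj.carrier)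
    (q : (P.gen p).obj.carrier) : fn (nerveGen α p) q = nerveFun α q.1 := by
  rw [nerveGen, fn_comp, fn_nerveApp, fn_comp, ← fn_comp (P.genIso p).inv, Iso.inv_hom_id, fn_id]
  rfl

/-- The morphism that induces a transformation between nerves. -/
noncomputable def nervePreimage (α : finNerve.obj P ⟶ finNerve.obj Q) : P ⟶ Q :=
  ofPMorphism ⟨nerveFun α, fun p p' h => by
      -- Both conditions involve only `p` and its successors, where `nerveFun α` agrees with the
      -- p-morphism `nerveGen α p`.
      have := stable (nerveGen α p) (p := P.genPoint p)
        (p' := ⟨p', P.reach_closed p p (P.mem_reach p) p' h⟩) h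
      exact fn_nerveGen α p (P.genPoint p) ▸ fn_nerveGen α p ⟨p', _⟩ ▸ this,
    fun p q h => by
      obtain ⟨p', hp', rfl⟩ := isOpen (nerveGen α p) (p := P.genPoint p) h
      exact ⟨p'.1, hp', (fn_nerveGen α p p').symm⟩⟩

theorem nerve_map_nervePreimage (α : finNerve.obj P ⟶ finNerve.obj Q) :
    finNerve.map (nervePreimage α) = α := by
  refine NatTrans.ext (funext fun A => ?_)
  refine ConcreteCategory.hom_ext _ _ fun (h : specFunctor.obj A.unop ⟶ P) => ?_
  exact hom_ext fun x => (fn_nerveApp α (A := A.unop) h x).symm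

theorem nerve_map_injective {f g : P ⟶ Q} (h : finNerve.map f = finNerve.map g) : f = g := by
  refine hom_ext fun p => ?_
  let i := (P.genIso p).hom ≫ P.genι p
  have e : i ≫ f = i ≫ g :=
    ConcreteCategory.congr_hom (NatTrans.congr_app h (op (P.gen_mem_essImage p).witness)) i
  rw [Category.assoc, Category.assoc, Iso.cancel_iso_hom_left] at e
  exact congrArg (fun k => fn k (P.genPoint p)) e

end LFKripkeFrame

open LFKripkeFrame

instance : (finNerve.{u}).Full where
  map_surjective α := ⟨nervePreimage α, nerve_map_nervePreimage α⟩

instance : (finNerve.{u}).Faithful where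
  map_injective h := nerve_map_injective h

/-! ### The nerve and filtered colimits -/

/-- The nerve sends filtered unions of frames to colimits. -/
noncomputable def finNerveIsColimit {J : Type u} [SmallCategory J] [IsFiltered J]
    {K : J ⥤ LFKripkeFrame.{u}} {c : Cocone K} (hc : IsFilteredUnion c) :
    IsColimit (finNerve.mapCocone c) :=
  evaluationJointlyReflectsColimits _ fun A =>
    Types.FilteredColimit.isColimitOf' _ _
      (fun m => by
        obtain ⟨j, g, hg⟩ := hc.exists_factor (N := specFunctor.obj A.unop) m
        exact ⟨j, g, hg.symm⟩)
      (fun j g h e => hc.exists_comp_eq (N := specFunctor.obj A.unop) g h e)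

/-- The nerve of a dual frame is representable. -/
noncomputable def yonedaIsoSpecFunctorCompFinNerve : yoneda ≅ specFunctor.{u} ⋙ finNerve :=
  NatIso.ofComponents
    (fun A => NatIso.ofComponents
      (fun B => ((Functor.FullyFaithful.ofFullyFaithful specFunctor).homEquiv
        (X := B.unop) (Y := A)).toIso)
      (fun f => ConcreteCategory.hom_ext _ _ fun h => specFunctor.map_comp f.unop h))
    (fun f => NatTrans.ext (funext fun _ =>
      ConcreteCategory.hom_ext _ _ fun h => specFunctor.map_comp h f))

theorem finNerve_isIndObject_of_isFilteredUnion {J : Type u} [SmallCategory J] [IsFiltered J]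
    (F : J ⥤ FinModAlg.{u}ᵒᵖ) {c : Cocone (F ⋙ specFunctor)} (hc : IsFilteredUnion c) :
    IsIndObject (finNerve.obj c.pt) :=
  let e : F ⋙ yoneda ≅ (F ⋙ specFunctor) ⋙ finNerve :=
    Functor.isoWhiskerLeft F yonedaIsoSpecFunctorCompFinNerve
  .mk (.ofCocone ((Cocone.precompose e.hom).obj (finNerve.mapCocone c))
    ((IsColimit.precomposeHomEquiv e _).symm (finNerveIsColimit hc)))

/-! ### Locally finite frames as directed unions of finite upsets -/

/-- The finite subsets of a frame that are closed under successors. -/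
abbrev FiniteUpset (P : LFKripkeFrame.{u}) : Type u :=
  {S : Set P.obj.carrier // S.Finite ∧ ∀ x ∈ S, ∀ y, P.obj.rel x y → y ∈ S}

instance (P : LFKripkeFrame.{u}) : Nonempty (FiniteUpset P) :=
  ⟨⟨∅, Set.finite_empty, fun _ h => h.elim⟩⟩

instance (P : LFKripkeFrame.{u}) : IsDirectedOrder (FiniteUpset P) :=
  ⟨fun S T => ⟨⟨S.1 ∪ T.1, S.2.1.union T.2.1, fun x hx y h =>
    hx.imp (S.2.2 x · y h) (T.2.2 x · y h)⟩, Set.subset_union_left, Set.subset_union_right⟩⟩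

/-- The diagram of the finite subframes of a frame. -/
def finiteUpsets (P : LFKripkeFrame.{u}) : FiniteUpset P ⥤ LFKripkeFrame.{u} where
  obj S := P.upset S.1
  map {S _} f := upsetMap S.2.2 f.le

/-- A locally finite frame as a cocone over its finite subframes. -/
def finiteUpsetsCocone (P : LFKripkeFrame.{u}) : Cocone (finiteUpsets P) where
  pt := P
  ι := { app S := P.upsetι S.1 S.2.2 }

theorem finiteUpsetsCocone_isFilteredUnion (P : LFKripkeFrame.{u}) :
    IsFilteredUnion (finiteUpsetsCocone P) where
  surj p := ⟨⟨P.reach p, P.finite_reach p, P.reach_closed p⟩, P.genPoint p, rfl⟩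
  inj S _ _ h := ⟨S, 𝟙 S, congrArg _ (Subtype.ext h)⟩

theorem LFKripkeFrame.IsFilteredUnion.precompose {J : Type u} [SmallCategory J]
    {K L : J ⥤ LFKripkeFrame.{u}} (e : L ≅ K) {c : Cocone K} (hc : IsFilteredUnion c) :
    IsFilteredUnion ((Cocone.precompose e.hom).obj c) where
  surj p := by
    obtain ⟨j, x, rfl⟩ := hc.surj p
    refine ⟨j, fn (e.inv.app j) x, ?_⟩
    change fn (e.hom.app j ≫ c.ι.app j) (fn (e.inv.app j) x) = _
    rw [← fn_comp, Iso.inv_hom_id_app_assoc]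
  inj j x y h := by
    obtain ⟨k, f, hf⟩ := hc.inj j (fn (e.hom.app j) x) (fn (e.hom.app j) y) h
    refine ⟨k, f, ?_⟩
    have hL : L.map f = (e.hom.app j ≫ K.map f) ≫ e.inv.app k := by
      rw [← e.hom.naturality, Category.assoc, Iso.hom_inv_id_app, Category.comp_id]
    rw [hL]
    exact congrArg (fn (e.inv.app k)) hf

theorem finNerve_isIndObject (P : LFKripkeFrame.{u}) : IsIndObject (finNerve.obj P) :=
  have h : ∀ S, specFunctor.essImage ((finiteUpsets P).obj S) := fun S =>
    mem_essImage_specFunctor _ S.2.1.to_subtype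
  finNerve_isIndObject_of_isFilteredUnion (Functor.essImage.liftFunctor _ specFunctor h)
    ((finiteUpsetsCocone_isFilteredUnion P).precompose
      (Functor.essImage.liftFunctorCompIso _ specFunctor h))

/-- Present `X` as a filtered colimit of representables; the colimit of the corresponding dual
frames has nerve `X`, since the nerve preserves that colimit. -/
theorem mem_essImage_finNerve (X : FinModAlg.{u}ᵒᵖᵒᵖ ⥤ Type u) (hX : IsIndObject X) :
    finNerve.essImage X := by
  let p := hX.presentation
  let e : p.F ⋙ yoneda ≅ (p.F ⋙ specFunctor) ⋙ finNerve :=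
    Functor.isoWhiskerLeft p.F yonedaIsoSpecFunctorCompFinNerve
  exact ⟨_, ⟨IsColimit.coconePointsIsoOfNatIso
    (finNerveIsColimit (colimitCocone_isFilteredUnion (p.F ⋙ specFunctor))) p.coconeIsColimit
    e.symm⟩⟩

/-! ### The equivalence with ind-objects -/

/-- The nerve, as a functor to ind-objects. -/
noncomputable def indNerve : LFKripkeFrame.{u} ⥤
    ObjectProperty.FullSubcategory (IsIndObject (C := FinModAlg.{u}ᵒᵖ)) :=
  ObjectProperty.lift _ finNerve finNerve_isIndObject

instance : (indNerve.{u}).EssSurj where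
  mem_essImage X := by
    obtain ⟨P, ⟨i⟩⟩ := mem_essImage_finNerve X.obj X.property
    exact ⟨P, ⟨ObjectProperty.isoMk _ i⟩⟩

instance : (indNerve.{u}).Full := inferInstanceAs (ObjectProperty.lift _ _ _).Full

instance : (indNerve.{u}).Faithful := inferInstanceAs (ObjectProperty.lift _ _ _).Faithful

instance : (indNerve.{u}).IsEquivalence where

/-- The Pro-completion of the category of finite modal algebras is dual to the category of locally
finite Kripke frames. -/
theorem mainTheorem3 :
    Nonempty (ProCompletion FinModAlg.{u} ≌ LFKripkeFrame.{u}ᵒᵖ) :=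
  ⟨((Ind.equivalence FinModAlg.{u}ᵒᵖ).trans indNerve.asEquivalence.symm).op⟩
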